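/- A permutation of length $n\ge 0$ is a bijection of $\{1,\dots,n\}$, written $\pi(1)\cdots\pi(n)$. A permutation $\sigma$ of length $k$ is contained in $\pi$ (of length $n$) if there are indices $1\le i_1<\cdots<i_k\le n$ such that $\pi(i_1)\cdots\pi(i_k)$ is order isomorphic to $\sigma$. A permutation class is a set of permutations closed downward under containment. A quasi-order is wqo if every infinite sequence $x_1,x_2,\dots$ of its elements has indices $i<j$ with $x_i\le x_j$; a set of permutations is wqo if it is wqo under containment. Given a quasi-order $(L,\le_L)$, an $L$-labeled permutation is a pair $(\pi,\ell_\pi)$ with $\ell_\pi:\{1,\dots,n\}\to L$, and $(\sigma,\ell_\sigma)$ is contained in $(\pi,\ell_\pi)$ if there are indices as above with, in addition, $\ell_\sigma(j)\le_L\ell_\pi(i_j)$ for all $1\le j\le k$. A set $\mathcal C$ of permutations is labeled well-quasi-ordered (lwqo) if, for every wqo $(L,\le_L)$, the set of all $L$-labeled members of $\mathcal C$ is wqo under this order. An interval of $\pi$ is a set $I$ of contiguous indices such that $\pi(I)$ is also contiguous; a permutation of length $n\ge 2$ is simple if its only intervals have lengths $0$, $1$ and $n$. For a $0/{\pm}1$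 matrix $M$, with entries $M(k,\ell)$ indexed by column $k$ (from left to right) and row $\ell$ (from bottom to top), let $\Lambda_M\subset\mathbb R^2$ be the union of the closed segments from $(k-1,\ell-1)$ to $(k,\ell)$ for $M(k,\ell)=1$ and from $(k-1,\ell)$ to $(k,\ell-1)$ for $M(k,\ell)=-1$. Let $\operatorname{Geom}(M)$ be the set of permutations in the same relative order as some finite subset of $\Lambda_M$ no two points of which lie on a common horizontal or vertical line. A set of permutations is geometrically griddable if it is contained in $\operatorname{Geom}(M)$ for some finite $0/{\pm}1$ matrix $M$. For a permutation $\sigma$ of length $m$ and nonempty permutations $\alpha_1,\dots,\alpha_m$, the inflation $\sigma[\alpha_1,\dots,\alpha_m]$ is obtained by replacing each entry $\sigma(i)$ by an interval order isomorphic to $\alpha_i$, the intervals themselves being in the relative order of $\sigma$. For classes $\mathcal C$ and $\mathcal U$, let $\mathcal C[\mathcal U]$ be the set of all inflations $\sigma[\alpha_1,\dots,\alpha_m]$ with $\sigma\in\mathcal C$ of length $m$ and nonempty $\alpha_1,\dots,\alpha_m\in\mathcal U$. **Theorem.** Let $\mathcal C$ be a permutation class such that the set of simple permutations in $\mathcal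 C$ is geometrically griddable. Then $\mathcal C$ is lwqo. Moreover, $\mathcal C[\mathcal U]$ is wqo for every wqo permutation class $\mathcal U$. -/

import Mathlib

universe u

/-- A finite permutation: a length `len` (possibly `0`) and a permutation of the `len` indices. -/
structure FinPerm where
  len : ℕ
  perm : Equiv.Perm (Fin len)

namespace FinPerm

/-- The containment order: `σ.Contained π` if some subsequence `π(i₁) ⋯ π(iₖ)` of `π` is
order isomorphic to `σ`. -/
def Contained (σ π : FinPerm) : Prop :=
  ∃ f : Fin σ.len ↪o Fin π.len,
    ∀ i j, σ.perm i < σ.perm j ↔ π.perm (f i) < π.perm (f j)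

/-- A permutation class: a set of permutations closed downward under containment. -/
def IsClass (C : Set FinPerm) : Prop :=
  ∀ π ∈ C, ∀ σ : FinPerm, σ.Contained π → σ ∈ C

/-- A set of permutations is wqo if it is so under containment. -/
def IsWQO (C : Set FinPerm) : Prop :=
  C.PartiallyWellOrderedOn Contained

/-- A set of contiguous indices whose set of values is also contiguous. -/
def IsInterval (π : FinPerm) (I : Set (Fin π.len)) : Prop :=
  I.OrdConnected ∧ (π.perm '' I).OrdConnected

/-- A permutation of length at least two is simple if all of its intervals have
length `0`, `1` or the full length. -/
def IsSimple (π : FinPerm) : Prop :=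
  2 ≤ π.len ∧ ∀ I : Set (Fin π.len), π.IsInterval I → I.ncard = 0 ∨ I.ncard = 1 ∨ I.ncard = π.len

/-- The inflation `σ[α₁, …, αₘ]`. The entry `j` of the `i`th block, which has position `(i, j)`
in the lexicographic order of the blocks from left to right, gets the value `αᵢ(j)` in the block
that is the `σ(i)`th from the bottom. -/
def inflate (σ : FinPerm) (α : Fin σ.len → FinPerm) : FinPerm where
  len := ∑ i, (α i).len
  perm :=
    (finSigmaFinEquiv (n := fun i => (α i).len)).symm
      |>.trans (Equiv.sigmaCongrRight fun i => (α i).perm)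
      |>.trans (Equiv.sigmaCongrLeft' (β := fun i => Fin (α i).len) σ.perm)
      |>.trans (finSigmaFinEquiv (n := fun k => (α (σ.perm.symm k)).len))
      |>.trans (finCongr (Equiv.sum_comp σ.perm.symm fun i => (α i).len))

/-- The inflation `C[U]`: all inflations of members of `C` by nonempty members of `U`. -/
def inflation (C U : Set FinPerm) : Set FinPerm :=
  {π | ∃ σ ∈ C, ∃ α : Fin σ.len → FinPerm,
    (∀ i, α i ∈ U ∧ 0 < (α i).len) ∧ π = σ.inflate α}

/-- A set of points in the plane is a drawing of `π` if, listing its points from left to right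
(with distinct first coordinates), their second coordinates are in the same relative order
as the entries of `π`. -/
def IsDrawing (S : Set (ℝ × ℝ)) (π : FinPerm) : Prop :=
  ∃ p : Fin π.len → ℝ × ℝ, Set.range p = S ∧
    (∀ i j, i < j ↔ (p i).1 < (p j).1) ∧
    (∀ i j, π.perm i < π.perm j ↔ (p i).2 < (p j).2)

/-- The standard figure of a `0/±1` matrix. Columns `k` are numbered from left to right and rows
`l` from bottom to top (column index first); indices start at `0`. -/
def standardFigure {t s : ℕ} (M : Matrix (Fin t) (Fin s) SignType) : Set (ℝ × ℝ) :=
  {z | ∃ (k : Fin t) (l : Fin s),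
    (M k l = 1 ∧ z ∈ segment ℝ ((k : ℝ), (l : ℝ)) ((k : ℝ) + 1, (l : ℝ) + 1)) ∨
    (M k l = -1 ∧ z ∈ segment ℝ ((k : ℝ), (l : ℝ) + 1) ((k : ℝ) + 1, (l : ℝ)))}

/-- The geometric grid class of `M`: the permutations that can be drawn on its standard figure. -/
def Geom {t s : ℕ} (M : Matrix (Fin t) (Fin s) SignType) : Set FinPerm :=
  {π | ∃ S : Set (ℝ × ℝ), S ⊆ standardFigure M ∧ IsDrawing S π}

/-- A set of permutations is geometrically griddable if a single geometric grid class contains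
all of it. -/
def GeometricallyGriddable (X : Set FinPerm) : Prop :=
  ∃ (t s : ℕ) (M : Matrix (Fin t) (Fin s) SignType), X ⊆ Geom M

end FinPerm

/-- A permutation with a label from `L` on each index. -/
structure LabeledPerm (L : Type u) extends FinPerm where
  label : Fin len → L

namespace LabeledPerm

/-- Containment of labeled permutations: a containment that maps each entry to an entry with a
label at least as large. -/
def Contained {L : Type u} [Preorder L] (σ π : LabeledPerm L) : Prop :=
  ∃ f : Fin σ.len ↪o Fin π.len,
    (∀ i j, σ.perm i < σ.perm j ↔ π.perm (f i) < π.perm (f j)) ∧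
    ∀ i, σ.label i ≤ π.label (f i)

end LabeledPerm

namespace FinPerm

/-- The set `C ≀ L` of `L`-labeled members of `C`. -/
def labeled (C : Set FinPerm) (L : Type u) : Set (LabeledPerm L) :=
  {π | π.toFinPerm ∈ C}

/-- `C` is labeled well-quasi-ordered: `C ≀ L` is wqo for every wqo `L`. -/
def IsLWQO (C : Set FinPerm) : Prop :=
  ∀ (L : Type u) [Preorder L], WellQuasiOrderedLE L →
    (labeled C L).PartiallyWellOrderedOn LabeledPerm.Contained

end FinPerm

/-! Two arguments combine. For a geometric grid class, list the points of a drawing by their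
horizontal distance from the centre of their cell, nearest first. The segments have slope ±1, so the
order of two listed points in either coordinate depends only on the quarter cells that contain them.
A labeled permutation thus becomes a word over a finite alphabet times `L`, and Higman's lemma
applies (`geom_subset_codedClass`, `isLWQO_codedClass`).

To pass from simple permutations to the class, take a minimal bad sequence of labeled permutations.
A term of length at least two is an inflation of a simple permutation, and its blocks are shorter
labeled patterns of it. By minimality all these blocks form a wqo, so they may serve as labels on
the simple quotients. A comparison of two labeled quotients lifts to the terms, a contradiction
(`IsClass.isLWQO_of_isSimple`). For `C[U]`, the labels are the members of `U`. -/

open Set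

namespace LabeledPerm

/-- Labeled permutations are quasi-ordered by containment. -/
instance instPreorder {L : Type u} [Preorder L] : Preorder (LabeledPerm L) where
  le := Contained
  le_refl _ := ⟨RelEmbedding.refl _, fun _ _ => Iff.rfl, fun _ => le_rfl⟩
  le_trans := by
    rintro σ τ π ⟨f, hf, hfl⟩ ⟨g, hg, hgl⟩
    exact ⟨f.trans g, fun i j => (hf i j).trans (hg _ _), fun i => (hfl i).trans (hgl _)⟩

end LabeledPerm

/-- Higman's lemma for words given as functions on `Fin`. -/
theorem WellQuasiOrdered.exists_orderEmbedding_fin {β : Type*} {r : β → β → Prop} [IsPreorder β r]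
    (hr : WellQuasiOrdered r) (len : ℕ → ℕ) (w : ∀ n, Fin (len n) → β) :
    ∃ m n, m < n ∧ ∃ f : Fin (len m) ↪o Fin (len n), ∀ i, r (w m i) (w n (f i)) := by
  have h := Set.PartiallyWellOrderedOn.partiallyWellOrderedOn_sublistForall₂ r
    (Set.partiallyWellOrderedOn_univ_iff.2 hr)
  obtain ⟨m, n, hmn, h⟩ := h.exists_lt (f := fun n => List.ofFn (w n)) (fun n x _ => mem_univ x)
  refine ⟨m, n, hmn, ?_⟩
  obtain ⟨l, hl, hs⟩ := List.sublistForall₂_iff.1 h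
  obtain ⟨f, hf⟩ := List.sublist_iff_exists_fin_orderEmbedding_get_eq.1 hs
  have hlen : len m = l.length := by simpa using hl.length_eq
  refine ⟨((Fin.castOrderIso hlen).toOrderEmbedding.trans f).trans
    (Fin.castOrderIso (List.length_ofFn)).toOrderEmbedding, fun i => ?_⟩
  have h1 := hl.get (i := i) (by simp) (by simp [← hlen])
  have h2 := hf (Fin.cast hlen i)
  simp only [List.get_eq_getElem, List.getElem_ofFn] at h1 h2
  simp only [Fin.val_cast] at h2
  rw [h2] at h1
  simpa using! h1

/-! ### Permutations coded by words over a finite alphabet. -/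

namespace FinPerm

/-- Permutations whose entries can be listed, with letters from `A`, in such a way that the relative
order of two entries is a function of their letters. -/
def codedClass {A : Type*} (R S : A → A → Prop) : Set FinPerm :=
  {π | ∃ (w : Equiv.Perm (Fin π.len)) (a : Fin π.len → A), ∀ s t, s < t →
    (w s < w t ↔ R (a s) (a t)) ∧ (π.perm (w s) < π.perm (w t) ↔ S (a s) (a t))}

/-- An embedding of words that preserves letters preserves both relative orders, since these are
read off the letters. Carrying the labels along in the word makes it a labeled containment. -/
theorem isLWQO_codedClass {A : Type*} [Finite A] (R S : A → A → Prop) :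
    IsLWQO.{u} (codedClass R S) := by
  intro L _ hL
  rw [Set.partiallyWellOrderedOn_iff_exists_lt]
  intro π hπ
  choose w a h using hπ
  have hwqo : WellQuasiOrdered fun x y : A × L => x.1 = y.1 ∧ x.2 ≤ y.2 :=
    (Finite.wellQuasiOrdered (· = ·)).prod hL.wqo
  have : IsPreorder (A × L) fun x y => x.1 = y.1 ∧ x.2 ≤ y.2 :=
    { refl _ := ⟨rfl, le_rfl⟩
      trans _ _ _ h h' := ⟨h.1.trans h'.1, h.2.trans h'.2⟩ }
  obtain ⟨m, n, hmn, f, hf⟩ := hwqo.exists_orderEmbedding_fin (fun n => (π n).len)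
    fun n i => (a n i, (π n).label (w n i))
  simp only at hf
  refine ⟨m, n, hmn, ?_⟩
  have key : ∀ s t, (w m s < w m t ↔ w n (f s) < w n (f t)) ∧
      ((π m).perm (w m s) < (π m).perm (w m t) ↔
        (π n).perm (w n (f s)) < (π n).perm (w n (f t))) := by
    have lt : ∀ s t, s < t → (w m s < w m t ↔ w n (f s) < w n (f t)) ∧
      ((π m).perm (w m s) < (π m).perm (w m t) ↔
        (π n).perm (w n (f s)) < (π n).perm (w n (f t))) := by
      intro s t hst
      have h1 := h m s t hst
      have h2 := h n (f s) (f t) (f.lt_iff_lt.2 hst)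
      rw [← (hf s).1, ← (hf t).1] at h2
      exact ⟨h1.1.trans h2.1.symm, h1.2.trans h2.2.symm⟩
    intro s t
    rcases lt_trichotomy s t with hst | rfl | hst
    · exact lt s t hst
    · simp
    -- The code only decides pairs in listing order; the reverse comparison is its negation, as
    -- distinct entries never tie.
    · have h1 := lt t s hst
      have e1 : w m s ≠ w m t := by simpa using hst.ne'
      have e2 : w n (f s) ≠ w n (f t) := by simpa using hst.ne'
      have e3 := (π m).perm.injective.ne e1
      have e4 := (π n).perm.injective.ne e2
      rw [← not_iff_not, not_lt, not_lt, e1.symm.le_iff_lt, e2.symm.le_iff_lt, h1.1,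
        ← not_iff_not (b := (π n).perm _ < _), not_lt, not_lt, e3.symm.le_iff_lt,
        e4.symm.le_iff_lt, h1.2]
      exact ⟨Iff.rfl, Iff.rfl⟩
  refine ⟨OrderEmbedding.ofStrictMono (fun i => w n (f ((w m).symm i))) fun i j hij => ?_,
    fun i j => ?_, fun i => ?_⟩
  · exact ((key _ _).1).1 (by simpa using hij)
  · simpa using! (key ((w m).symm i) ((w m).symm j)).2
  · simpa using! (hf ((w m).symm i)).2

/-! ### Geometric grid classes are coded. -/

/-- The coordinate of the point in the `k`th half-unit interval at distance `d` from
the midpoint of the unit interval that contains it. -/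
noncomputable def halfCoord (k : ℕ) (d : ℝ) : ℝ :=
  if Even k then (k + 1) / 2 - d else k / 2 + d

theorem halfCoord_two_mul (k : ℕ) (d : ℝ) : halfCoord (2 * k) d = k + 1 / 2 - d := by
  simp [halfCoord]; ring

theorem halfCoord_two_mul_add_one (k : ℕ) (d : ℝ) :
    halfCoord (2 * k + 1) d = k + 1 / 2 + d := by
  simp [halfCoord]; ring

theorem halfCoord_mem {k : ℕ} {d : ℝ} (h0 : 0 ≤ d) (h1 : d ≤ 1 / 2) :
    halfCoord k d ∈ Icc ((k : ℝ) / 2) ((k + 1) / 2) := by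
  unfold halfCoord
  split_ifs <;> constructor <;> linarith

/-- Moving away from the midpoint decreases the coordinate in a left half (`k` even) and increases
it in a right half (`k` odd). Excluding equality handles common endpoints of halves and equal
distances. -/
theorem halfCoord_lt_iff {k k' : ℕ} {d d' : ℝ} (h0 : 0 ≤ d) (h1 : d' ≤ 1 / 2) (h : d ≤ d')
    (hne : halfCoord k d ≠ halfCoord k' d') :
    halfCoord k d < halfCoord k' d' ↔ k < k' ∨ k = k' ∧ Odd k := by
  have H := halfCoord_mem (k := k) h0 (h.trans h1)
  have H' := halfCoord_mem (k := k') (h0.trans h) h1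
  rcases lt_trichotomy k k' with hk | rfl | hk
  · have : (k : ℝ) + 1 ≤ k' := by exact_mod_cast hk
    simp only [hk, true_or, iff_true]
    exact lt_of_le_of_ne (by linarith [H.2, H'.1]) hne
  · rcases Nat.even_or_odd k with hk | hk
    · have : ¬ Odd k := by simpa using hk
      simp only [this, halfCoord, hk, if_true, lt_irrefl, and_false, or_false, iff_false]
      linarith
    · have : ¬ Even k := by simpa using hk
      simp only [halfCoord, this, if_false, ne_eq, lt_irrefl, hk, and_self, or_true,
        iff_true] at hne ⊢
      exact lt_of_le_of_ne (by linarith) hne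
  · have : (k' : ℝ) + 1 ≤ k := by exact_mod_cast hk
    have h1 : ¬ (k < k' ∨ k = k' ∧ Odd k) := by omega
    simp only [h1, iff_false, not_lt]
    linarith [H.1, H'.2]

/-- On a diagonal of a unit cell both coordinates are equally far from their midpoints, so a single
`d` serves for both. -/
theorem exists_halfCoord_of_mem_standardFigure {t s : ℕ} {M : Matrix (Fin t) (Fin s) SignType}
    {z : ℝ × ℝ} (hz : z ∈ standardFigure M) :
    ∃ (a : Fin (2 * t) × Fin (2 * s)) (d : ℝ), 0 ≤ d ∧ d ≤ 1 / 2 ∧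
      z.1 = halfCoord a.1 d ∧ z.2 = halfCoord a.2 d := by
  obtain ⟨k, l, h⟩ := hz
  let k₀ : Fin (2 * t) := ⟨2 * k, by omega⟩
  let k₁ : Fin (2 * t) := ⟨2 * k + 1, by omega⟩
  let l₀ : Fin (2 * s) := ⟨2 * l, by omega⟩
  let l₁ : Fin (2 * s) := ⟨2 * l + 1, by omega⟩
  rcases h with ⟨-, h⟩ | ⟨-, h⟩ <;> rw [segment_eq_image] at h <;>
    obtain ⟨c, ⟨h0, h1⟩, rfl⟩ := h <;> rcases le_total c (1 / 2) with hc | hc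
  · refine ⟨(k₀, l₀), 1 / 2 - c, by linarith, by linarith, ?_, ?_⟩ <;>
      simp only [k₀, l₀, halfCoord_two_mul, Prod.fst_add, Prod.snd_add, Prod.smul_fst,
        Prod.smul_snd, smul_eq_mul] <;> ring
  · refine ⟨(k₁, l₁), c - 1 / 2, by linarith, by linarith, ?_, ?_⟩ <;>
      simp only [k₁, l₁, halfCoord_two_mul_add_one, Prod.fst_add, Prod.snd_add, Prod.smul_fst,
        Prod.smul_snd, smul_eq_mul] <;> ring
  · refine ⟨(k₀, l₁), 1 / 2 - c, by linarith, by linarith, ?_, ?_⟩ <;>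
      simp only [k₀, l₁, halfCoord_two_mul, halfCoord_two_mul_add_one, Prod.fst_add, Prod.snd_add,
        Prod.smul_fst, Prod.smul_snd, smul_eq_mul] <;> ring
  · refine ⟨(k₁, l₀), c - 1 / 2, by linarith, by linarith, ?_, ?_⟩ <;>
      simp only [k₁, l₀, halfCoord_two_mul, halfCoord_two_mul_add_one, Prod.fst_add, Prod.snd_add,
        Prod.smul_fst, Prod.smul_snd, smul_eq_mul] <;> ring

theorem geom_subset_codedClass {t s : ℕ} (M : Matrix (Fin t) (Fin s) SignType) :
    Geom M ⊆ codedClass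
      (fun a b : Fin (2 * t) × Fin (2 * s) => (a.1 : ℕ) < b.1 ∨ (a.1 : ℕ) = b.1 ∧ Odd (a.1 : ℕ))
      (fun a b => (a.2 : ℕ) < b.2 ∨ (a.2 : ℕ) = b.2 ∧ Odd (a.2 : ℕ)) := by
  rintro π ⟨S, hS, p, rfl, hx, hy⟩
  choose a d hd0 hd1 hax hay using
    fun i => exists_halfCoord_of_mem_standardFigure (hS (mem_range_self (f := p) i))
  have key : ∀ i j, i ≠ j → d i ≤ d j →
      (i < j ↔ ((a i).1 : ℕ) < (a j).1 ∨ ((a i).1 : ℕ) = (a j).1 ∧ Odd ((a i).1 : ℕ)) ∧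
      (π.perm i < π.perm j ↔
        ((a i).2 : ℕ) < (a j).2 ∨ ((a i).2 : ℕ) = (a j).2 ∧ Odd ((a i).2 : ℕ)) := by
    intro i j hne hd
    have hnx : (p i).1 ≠ (p j).1 := by
      intro h
      rcases hne.lt_or_gt with h' | h'
      · exact ((hx _ _).1 h').ne h
      · exact ((hx _ _).1 h').ne' h
    have hny : (p i).2 ≠ (p j).2 := by
      intro h
      rcases (π.perm.injective.ne hne).lt_or_gt with h' | h'
      · exact ((hy _ _).1 h').ne h
      · exact ((hy _ _).1 h').ne' h
    rw [hx, hy]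
    rw [hax, hax] at hnx ⊢
    rw [hay, hay] at hny ⊢
    exact ⟨halfCoord_lt_iff (hd0 i) (hd1 j) hd hnx, halfCoord_lt_iff (hd0 i) (hd1 j) hd hny⟩
  exact ⟨Tuple.sort d, a ∘ Tuple.sort d, fun i j hij =>
    key _ _ (by simpa using hij.ne) (Tuple.monotone_sort d hij.le)⟩

theorem IsLWQO.mono {C D : Set FinPerm} (hD : IsLWQO.{u} D) (h : C ⊆ D) : IsLWQO.{u} C :=
  fun L _ hL => (hD L hL).mono fun _ hπ => h hπ

theorem GeometricallyGriddable.isLWQO {X : Set FinPerm} (hX : GeometricallyGriddable X) :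
    IsLWQO.{u} X := by
  obtain ⟨t, s, M, h⟩ := hX
  exact (isLWQO_codedClass _ _).mono (h.trans (geom_subset_codedClass M))

/-! ### Patterns, blocks and simple quotients. -/

/-- The pattern of a permutation on a set of indices. -/
noncomputable def restrict (π : FinPerm) (P : Finset (Fin π.len)) : FinPerm where
  len := P.card
  -- Sorting sends a rank to the position of the value with that rank; the inverse sends a position
  -- to its rank.
  perm := (Tuple.sort fun i => π.perm (P.orderEmbOfFin rfl i))⁻¹

theorem restrict_perm_lt_iff (π : FinPerm) (P : Finset (Fin π.len)) (i j : Fin P.card) :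
    (π.restrict P).perm i < (π.restrict P).perm j ↔
      π.perm (P.orderEmbOfFin rfl i) < π.perm (P.orderEmbOfFin rfl j) := by
  set v : Fin P.card → Fin π.len := fun i => π.perm (P.orderEmbOfFin rfl i)
  have hv : StrictMono (v ∘ Tuple.sort v) :=
    (Tuple.monotone_sort v).strictMono_of_injective
      ((π.perm.injective.comp (P.orderEmbOfFin rfl).injective).comp (Tuple.sort v).injective)
  change (Tuple.sort v)⁻¹ i < (Tuple.sort v)⁻¹ j ↔ v i < v j
  rw [← hv.lt_iff_lt]
  simp

theorem restrict_contained (π : FinPerm) (P : Finset (Fin π.len)) : (π.restrict P).Contained π :=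
  ⟨P.orderEmbOfFin rfl, π.restrict_perm_lt_iff P⟩

/-- An idempotent map, as a choice of one index from each block of a partition of
`π` into intervals. -/
structure IsBlockRetraction (π : FinPerm) (r : Fin π.len → Fin π.len) : Prop where
  idem : ∀ i, r (r i) = r i
  lt_iff : ∀ i j, r i ≠ r j → (i < j ↔ r i < r j)
  perm_lt_iff : ∀ i j, r i ≠ r j → (π.perm i < π.perm j ↔ π.perm (r i) < π.perm (r j))

theorem isBlockRetraction_id (π : FinPerm) : π.IsBlockRetraction id :=
  ⟨fun _ => rfl, fun _ _ _ => Iff.rfl, fun _ _ _ => Iff.rfl⟩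

end FinPerm

theorem Set.OrdConnected.lt_iff_lt_of_mem {α : Type*} [LinearOrder α] {s : Set α}
    (hs : s.OrdConnected) {a b c : α} (ha : a ∈ s) (hc : c ∈ s) (hb : b ∉ s) :
    (a < b ↔ c < b) ∧ (b < a ↔ b < c) := by
  have key : ∀ a ∈ s, ∀ c ∈ s, (a < b → c < b) ∧ (b < a → b < c) := by
    intro a ha c hc
    constructor <;> intro h <;> by_contra! h'
    · exact hb (hs.out ha hc ⟨h.le, h'⟩)
    · exact hb (hs.out hc ha ⟨h', h.le⟩)
  exact ⟨⟨(key a ha c hc).1, (key c hc a ha).1⟩, ⟨(key a ha c hc).2, (key c hc a ha).2⟩⟩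

namespace FinPerm

/-- No index in `P` outside of `J` separates two indices in `J` by position or by value. -/
def IsIntervalIn (π : FinPerm) (P J : Set (Fin π.len)) : Prop :=
  ∀ a ∈ J, ∀ c ∈ J, ∀ b ∈ P, b ∉ J →
    ((a < b ↔ c < b) ∧ (b < a ↔ b < c)) ∧
    ((π.perm a < π.perm b ↔ π.perm c < π.perm b) ∧ (π.perm b < π.perm a ↔ π.perm b < π.perm c))

theorem isSimple_restrict {π : FinPerm} {P : Finset (Fin π.len)} (h2 : 2 ≤ P.card)
    (h : ∀ J : Set (Fin π.len), J ⊆ P → π.IsIntervalIn P J → J.Nontrivial → J = P) :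
    (π.restrict P).IsSimple := by
  refine ⟨h2, fun (I : Set (Fin P.card)) hI => ?_⟩
  have hI1 : I.OrdConnected := hI.1
  have hI2 : ((π.restrict P).perm '' I).OrdConnected := hI.2
  rcases I.subsingleton_or_nontrivial with hsub | hnt
  · have : I.ncard ≤ 1 := Set.ncard_le_one_iff_subsingleton.2 hsub
    change I.ncard = 0 ∨ I.ncard = 1 ∨ _
    omega
  right; right
  let e := P.orderEmbOfFin rfl
  have hrange : Set.range e = P := Finset.range_orderEmbOfFin P rfl
  have hJ : e '' I = P := by
    refine h _ ?_ ?_ (hnt.image e.injective)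
    · rw [← hrange]
      exact Set.image_subset_range _ _
    · rintro _ ⟨a, ha, rfl⟩ _ ⟨c, hc, rfl⟩ b hb hbI
      rw [← hrange] at hb
      obtain ⟨b, rfl⟩ := hb
      rw [e.injective.mem_set_image] at hbI
      have h1 := hI1.lt_iff_lt_of_mem ha hc hbI
      have h2 := hI2.lt_iff_lt_of_mem (mem_image_of_mem _ ha) (mem_image_of_mem _ hc)
        (b := (π.restrict P).perm b)
        fun ⟨x, hx, hxb⟩ => hbI ((π.restrict P).perm.injective hxb ▸ hx)
      simp only [restrict_perm_lt_iff] at h2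
      simp only [e.lt_iff_lt]
      exact ⟨h1, h2⟩
  change I.ncard = P.card
  rw [← Set.ncard_image_of_injective I e.injective, hJ, Set.ncard_coe_finset]

/-- Collapsing an interval of the pattern on the range of a block retraction. -/
theorem IsBlockRetraction.collapse {π : FinPerm} {r : Fin π.len → Fin π.len}
    (hr : π.IsBlockRetraction r) {J : Set (Fin π.len)} [DecidablePred (· ∈ J)]
    (hJ : π.IsIntervalIn (Set.range r) J) {c : Fin π.len} (hc : c ∈ J) (hrc : r c = c) :
    π.IsBlockRetraction fun i => if r i ∈ J then c else r i := by
  have key : ∀ i j, (if r i ∈ J then c else r i) ≠ (if r j ∈ J then c else r j) →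
      r i ≠ r j ∧ (r i < r j ↔ (if r i ∈ J then c else r i) < (if r j ∈ J then c else r j)) ∧
      (π.perm (r i) < π.perm (r j) ↔ π.perm (if r i ∈ J then c else r i) <
        π.perm (if r j ∈ J then c else r j)) := by
    intro i j hij
    refine ⟨fun h => hij (by rw [h]), ?_⟩
    split_ifs at hij ⊢ with h1 h2 h2
    · exact absurd rfl hij
    · have := hJ _ h1 _ hc _ (mem_range_self j) h2
      exact ⟨this.1.1, this.2.1⟩
    · have := hJ _ h2 _ hc _ (mem_range_self i) h1
      exact ⟨this.1.2, this.2.2⟩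
    · exact ⟨Iff.rfl, Iff.rfl⟩
  refine ⟨fun i => ?_, fun i j hij => ?_, fun i j hij => ?_⟩
  · by_cases h : r i ∈ J
    · simp only [h, if_true, hrc, hc]
    · simp only [h, if_false, hr.idem]
  · exact (hr.lt_iff i j (key i j hij).1).trans (key i j hij).2.1
  · exact (hr.perm_lt_iff i j (key i j hij).1).trans (key i j hij).2.2

/-- Every permutation of length at least two is an inflation of a simple permutation. -/
theorem exists_isBlockRetraction_isSimple (π : FinPerm) (hπ : 2 ≤ π.len) :
    ∃ r, π.IsBlockRetraction r ∧ (π.restrict (Finset.univ.image r)).IsSimple := by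
  classical
  -- Minimize the number of blocks, subject to having at least two. If the representatives had a
  -- proper nontrivial interval `J`, collapsing it to `c` would lose `d` but keep `c` and some `b`
  -- outside `J`.
  have hex : ∃ m, ∃ r, π.IsBlockRetraction r ∧ 2 ≤ (Finset.univ.image r).card ∧
      (Finset.univ.image r).card = m :=
    ⟨_, id, π.isBlockRetraction_id, by simpa using hπ, rfl⟩
  obtain ⟨r, hr, h2, hm⟩ := Nat.find_spec hex
  refine ⟨r, hr, isSimple_restrict h2 fun J hJr hJ hnt => ?_⟩
  rw [Finset.coe_image, Finset.coe_univ, Set.image_univ] at *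
  by_contra hne
  obtain ⟨c, hc, d, hd, hcd⟩ := hnt
  obtain ⟨b, hb, hbJ⟩ := Set.exists_of_ssubset (hJr.ssubset_of_ne hne)
  have hfix : ∀ x ∈ Set.range r, r x = x := by
    rintro _ ⟨i, rfl⟩
    exact hr.idem i
  refine Nat.find_min hex (m := _) ?_ ⟨_, hr.collapse hJ hc (hfix c (hJr hc)), ?_, rfl⟩
  · rw [← hm]
    refine Finset.card_lt_card ((Finset.ssubset_iff_of_subset fun x hx => ?_).2 ⟨d, ?_, ?_⟩)
    · obtain ⟨i, -, rfl⟩ := Finset.mem_image.1 hx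
      split_ifs
      · simpa using hJr hc
      · exact Finset.mem_image_of_mem _ (Finset.mem_univ _)
    · simpa using hJr hd
    · intro hmem
      obtain ⟨i, -, hi⟩ := Finset.mem_image.1 hmem
      split_ifs at hi with h3
      · exact hcd hi
      · exact h3 (hi ▸ hd)
  · refine Finset.one_lt_card.2 ⟨c, Finset.mem_image.2 ⟨c, Finset.mem_univ _, ?_⟩,
      b, Finset.mem_image.2 ⟨b, Finset.mem_univ _, ?_⟩, fun h => hbJ (h ▸ hc)⟩
    · rw [hfix c (hJr hc), if_pos hc]
    · rw [hfix b hb, if_neg hbJ]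

end FinPerm

/-! ### Labeled blocks and reassembly from them. -/

namespace LabeledPerm

variable {L : Type u}

/-- The labeled pattern of a labeled permutation on a set of indices. -/
noncomputable def restrict (π : LabeledPerm L) (P : Finset (Fin π.len)) : LabeledPerm L where
  toFinPerm := π.toFinPerm.restrict P
  label i := π.label (P.orderEmbOfFin rfl i)

/-- The block of a retraction that contains the `k`th index of its range. -/
noncomputable def block (π : LabeledPerm L) (r : Fin π.len → Fin π.len)
    (k : Fin (Finset.univ.image r).card) : LabeledPerm L :=
  π.restrict (Finset.univ.filter fun i => r i = (Finset.univ.image r).orderEmbOfFin rfl k)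

theorem block_len_lt (π : LabeledPerm L) (r : Fin π.len → Fin π.len)
    (hr : 2 ≤ (Finset.univ.image r).card) (k : Fin (Finset.univ.image r).card) :
    (π.block r k).len < π.len := by
  change (Finset.univ.filter fun i => r i = _).card < _
  conv_rhs => rw [← Finset.card_fin π.len]
  refine Finset.card_lt_card (Finset.filter_ssubset.2 ?_)
  obtain ⟨x, hx, hxk⟩ := Finset.exists_mem_ne hr ((Finset.univ.image r).orderEmbOfFin rfl k)
  obtain ⟨i, -, rfl⟩ := Finset.mem_image.1 hx
  exact ⟨i, Finset.mem_univ _, hxk⟩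

variable [Preorder L]

theorem restrict_le (π : LabeledPerm L) (P : Finset (Fin π.len)) : π.restrict P ≤ π :=
  ⟨P.orderEmbOfFin rfl, π.toFinPerm.restrict_perm_lt_iff P, fun _ => le_rfl⟩

theorem exists_map_of_restrict_le {σ π : LabeledPerm L} [Nonempty (Fin π.len)]
    {P : Finset (Fin σ.len)} {Q : Finset (Fin π.len)} (h : σ.restrict P ≤ π.restrict Q) :
    ∃ h : Fin σ.len → Fin π.len, (∀ i ∈ P, h i ∈ Q) ∧
      (∀ i ∈ P, ∀ j ∈ P, (i < j ↔ h i < h j) ∧ (σ.perm i < σ.perm j ↔ π.perm (h i) < π.perm (h j)))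
      ∧ ∀ i ∈ P, σ.label i ≤ π.label (h i) := by
  obtain ⟨f, hf, hl⟩ := h
  change Fin P.card ↪o Fin Q.card at f
  set e := P.orderEmbOfFin rfl
  set e' := Q.orderEmbOfFin rfl
  have hP : ∀ i ∈ P, ∃ a, e a = i := by
    intro i hi
    have : i ∈ Set.range e := by rw [Finset.range_orderEmbOfFin]; exact hi
    exact this
  have hext : ∀ a, Function.extend e (fun a => e' (f a)) (fun _ => Classical.arbitrary _) (e a) =
    e' (f a) := fun a => e.injective.extend_apply _ _ _
  -- The value outside `P` is arbitrary and never used; a total map avoids dependent types when the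
  -- blocks are glued.
  refine ⟨Function.extend e (fun a => e' (f a)) fun _ => Classical.arbitrary _, ?_, ?_, ?_⟩
  · intro i hi
    obtain ⟨a, rfl⟩ := hP i hi
    rw [hext]
    exact Finset.orderEmbOfFin_mem _ _ _
  · intro i hi j hj
    obtain ⟨a, rfl⟩ := hP i hi
    obtain ⟨b, rfl⟩ := hP j hj
    rw [hext, hext]
    refine ⟨by simp, ?_⟩
    have := hf a b
    exact (FinPerm.restrict_perm_lt_iff _ _ _ _).symm.trans
      (this.trans (FinPerm.restrict_perm_lt_iff _ _ _ _))
  · intro i hi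
    obtain ⟨a, rfl⟩ := hP i hi
    rw [hext]
    exact hl a

/-- Two entries of one block are compared by the embedding of that block, and entries of different
blocks by their representatives, hence by `f`. -/
theorem le_of_block_le {σ π : LabeledPerm L} [Nonempty (Fin π.len)] {r : Fin σ.len → Fin σ.len}
    {q : Fin π.len → Fin π.len} (hr : σ.IsBlockRetraction r) (hq : π.IsBlockRetraction q)
    (f : Fin (Finset.univ.image r).card ↪o Fin (Finset.univ.image q).card)
    (hf : ∀ a b, σ.perm ((Finset.univ.image r).orderEmbOfFin rfl a) <
        σ.perm ((Finset.univ.image r).orderEmbOfFin rfl b) ↔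
      π.perm ((Finset.univ.image q).orderEmbOfFin rfl (f a)) <
        π.perm ((Finset.univ.image q).orderEmbOfFin rfl (f b)))
    (hb : ∀ k, σ.block r k ≤ π.block q (f k)) : σ ≤ π := by
  choose h hmem hlt hl using fun k => exists_map_of_restrict_le (hb k)
  simp only [Finset.mem_filter, Finset.mem_univ, true_and] at hmem hlt hl
  set e := (Finset.univ.image r).orderEmbOfFin rfl
  set e' := (Finset.univ.image q).orderEmbOfFin rfl
  have hk : ∀ i, ∃ k, r i = e k := by
    intro i
    have : r i ∈ Set.range e := by rw [Finset.range_orderEmbOfFin]; simp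
    obtain ⟨k, hk⟩ := this
    exact ⟨k, hk.symm⟩
  choose k hk using hk
  have key : ∀ i j, (i < j ↔ h (k i) i < h (k j) j) ∧
      (σ.perm i < σ.perm j ↔ π.perm (h (k i) i) < π.perm (h (k j) j)) := by
    intro i j
    by_cases hij : k i = k j
    · have := hlt (k j) i (by rw [hk, hij]) j (hk j)
      rwa [hij]
    · have h1 : r i ≠ r j := by rw [hk, hk]; exact e.injective.ne hij
      have h2 : q (h (k i) i) ≠ q (h (k j) j) := by
        rw [hmem _ _ (hk i), hmem _ _ (hk j)]
        exact e'.injective.ne (f.injective.ne hij)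
      rw [hr.lt_iff i j h1, hr.perm_lt_iff i j h1, hq.lt_iff _ _ h2, hq.perm_lt_iff _ _ h2,
        hmem _ _ (hk i), hmem _ _ (hk j), hk i, hk j]
      exact ⟨by simp, hf _ _⟩
  exact ⟨OrderEmbedding.ofStrictMono (fun i => h (k i) i) fun i j hij => (key i j).1.1 hij,
    fun i j => (key i j).2, fun i => hl _ _ (hk i)⟩

end LabeledPerm

/-! ### Minimal bad sequences: from simple permutations to the class. -/

/-- The elements below a term of a minimal bad sequence, and of smaller rank, are
partially well-ordered. -/
theorem Set.PartiallyWellOrderedOn.of_isMinBadSeq {α : Type*} {r : α → α → Prop} [IsPreorder α r]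
    {rk : α → ℕ} {s : Set α} {f : ℕ → α} (hf : IsBadSeq r s f)
    (hmin : ∀ n, IsMinBadSeq r rk s n f) :
    {a ∈ s | ∃ n, r a (f n) ∧ rk a < rk (f n)}.PartiallyWellOrderedOn r := by
  rw [Set.partiallyWellOrderedOn_iff_exists_lt]
  intro g hg
  choose hgs idx hle hrk using hg
  by_contra! hbad
  -- Splice `g`, from `i₀` on, after the terms of `f` before `idx i₀`. Since `idx i₀` is least, a
  -- relation from such an `f m` to a later `g i` would give one from `f m` to `f (idx i)` with `m <
  -- idx i`. The spliced sequence is therefore bad, against minimality at `idx i₀`.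
  let i₀ := Function.argmin idx
  have hi₀ : ∀ i, idx i₀ ≤ idx i := fun i => Function.argmin_le idx i
  refine hmin (idx i₀) (fun m => if m < idx i₀ then f m else g (i₀ + (m - idx i₀)))
    (fun m hm => by simp [hm]) (by simpa using hrk i₀) ⟨fun n => ?_, fun m n hmn => ?_⟩
  · dsimp only
    split_ifs
    exacts [hf.1 n, hgs _]
  · dsimp only
    split_ifs with h1 h2 h2
    · exact hf.2 m n hmn
    · exact fun h => hf.2 m _ (h1.trans_le (hi₀ _)) (_root_.trans h (hle _))
    · omega
    · exact hbad _ _ (by omega)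

namespace FinPerm

/-- A class is lwqo if its simple members are. -/
theorem IsClass.isLWQO_of_isSimple {C : Set FinPerm} (hC : IsClass C)
    (hS : IsLWQO.{u} {σ ∈ C | σ.IsSimple}) : IsLWQO.{u} C := by
  intro L _ hL
  rw [Set.PartiallyWellOrderedOn.iff_not_exists_isMinBadSeq fun π => π.len]
  rintro ⟨f, hbad, hmin⟩
  have : IsPreorder (LabeledPerm L) LabeledPerm.Contained :=
    { refl := fun π => le_refl π
      trans := fun _ _ _ h h' => le_trans (α := LabeledPerm L) h h' }
  have hR := Set.PartiallyWellOrderedOn.of_isMinBadSeq hbad hmin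
  set R := {α ∈ labeled C L | ∃ n, LabeledPerm.Contained α (f n) ∧ α.len < (f n).len}
  -- `R` lies in the same universe as `L`, so it can itself serve as the set of labels in `hS`.
  have hR' : WellQuasiOrderedLE R := ⟨hR⟩
  have hsmall : IsLWQO.{u} {σ : FinPerm | σ.len ≤ 1} := by
    refine (isLWQO_codedClass (A := Unit) (fun _ _ => True) fun _ _ => True).mono ?_
    intro σ (hσ : σ.len ≤ 1)
    exact ⟨1, fun _ => (), fun s t hst => by omega⟩
  have hlarge : {π | ∃ n, π = f n ∧ 2 ≤ π.len}.PartiallyWellOrderedOn LabeledPerm.Contained := by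
    rw [Set.partiallyWellOrderedOn_iff_exists_lt]
    intro π hπ
    choose N hN h2 using hπ
    choose r hr hsimple using fun n => exists_isBlockRetraction_isSimple _ (h2 n)
    have hblock : ∀ n k, (π n).block (r n) k ∈ R := by
      intro n k
      refine ⟨hC _ (hN n ▸ hbad.1 (N n)) _ (restrict_contained _ _), N n, ?_, ?_⟩
      · rw [← hN]
        exact LabeledPerm.restrict_le _ _
      · rw [← hN]
        exact LabeledPerm.block_len_lt _ _ (hsimple n).1 k
    obtain ⟨m, n, hmn, g, hg, hgl⟩ := (hS R hR').exists_lt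
      (f := fun n => ⟨(π n).toFinPerm.restrict (Finset.univ.image (r n)),
        fun k => ⟨(π n).block (r n) k, hblock n k⟩⟩)
      (fun n => ⟨hC _ (hN n ▸ hbad.1 (N n)) _ (restrict_contained _ _), hsimple n⟩)
    have : Nonempty (Fin (π n).len) := ⟨⟨0, by have := h2 n; omega⟩⟩
    exact ⟨m, n, hmn, LabeledPerm.le_of_block_le (hr m) (hr n) g (fun a b =>
      (restrict_perm_lt_iff _ _ a b).symm.trans ((hg a b).trans (restrict_perm_lt_iff _ _ _ _))) hgl⟩
  obtain ⟨m, n, hmn, h⟩ := ((hsmall L hL).union hlarge).exists_lt (f := f) fun n => by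
    rcases Nat.lt_or_ge 1 (f n).len with h | h
    · exact Or.inr ⟨n, rfl, h⟩
    · exact Or.inl h
  exact hbad.2 m n hmn h

end FinPerm

/-! ### Inflations. -/

theorem finSigmaFinEquiv_lt_iff {m : ℕ} {n : Fin m → ℕ} (x y : (i : Fin m) × Fin (n i)) :
    finSigmaFinEquiv x < finSigmaFinEquiv y ↔
      x.1 < y.1 ∨ ∃ h : x.1 = y.1, Fin.cast (congrArg n h) x.2 < y.2 := by
  have hlt : ∀ x y : (i : Fin m) × Fin (n i), x.1 < y.1 →
      finSigmaFinEquiv x < finSigmaFinEquiv y := by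
    rintro ⟨i, a⟩ ⟨j, b⟩ (hij : i < j)
    rw [Fin.lt_def, finSigmaFinEquiv_apply, finSigmaFinEquiv_apply]
    -- Extending the block lengths by `0` makes block offsets sums over `Finset.range`, so a later
    -- block starts no earlier than the end of block `i`.
    let N : ℕ → ℕ := fun k => if h : k < m then n ⟨k, h⟩ else 0
    have hN : ∀ i : Fin m, ∑ k : Fin i, n (Fin.castLE i.2.le k) = ∑ k ∈ Finset.range i, N k := by
      intro i
      rw [← Fin.sum_univ_eq_sum_range]
      refine Finset.sum_congr rfl fun k _ => ?_
      simp [N, k.2.trans i.2, Fin.castLE]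
    simp only
    rw [hN, hN]
    have h1 : ∑ k ∈ Finset.range (i + 1), N k ≤ ∑ k ∈ Finset.range j, N k :=
      Finset.sum_le_sum_of_subset (Finset.range_subset_range.2 hij)
    rw [Finset.sum_range_succ] at h1
    have h2 : N i = n i := by simp [N]
    have := a.2
    omega
  rcases x with ⟨i, a⟩
  rcases y with ⟨j, b⟩
  rcases lt_trichotomy i j with h | rfl | h
  · simp [hlt ⟨i, a⟩ ⟨j, b⟩ h, h]
  · rw [Fin.lt_def, finSigmaFinEquiv_apply, finSigmaFinEquiv_apply]
    simp
  · have := hlt ⟨j, b⟩ ⟨i, a⟩ h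
    simp [this.not_gt, h.not_gt, h.ne']

namespace FinPerm

/-- Stated in `ℕ` because the two sides live in `Fin` types whose lengths sum the blocks in
different orders, by position and by value. -/
theorem inflate_perm_apply (σ : FinPerm) (α : Fin σ.len → FinPerm) (i : Fin σ.len)
    (a : Fin (α i).len) :
    (((σ.inflate α).perm (finSigmaFinEquiv ⟨i, a⟩) : Fin (∑ i, (α i).len)) : ℕ) =
      finSigmaFinEquiv (n := fun k => (α (σ.perm.symm k)).len)
        ⟨σ.perm i, Fin.cast (by simp) ((α i).perm a)⟩ := by
  have hleft : (Equiv.sigmaCongrLeft' (β := fun i => Fin (α i).len) σ.perm)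
      ⟨i, (α i).perm a⟩ = ⟨σ.perm i, Fin.cast (by simp) ((α i).perm a)⟩ := by
    rw [Equiv.sigmaCongrLeft', Equiv.symm_apply_eq]
    refine Sigma.ext (σ.perm.symm_apply_apply i).symm ?_
    exact (Fin.heq_ext_iff (by simp)).2 rfl
  rw [← hleft]
  change ((finSigmaFinEquiv (n := fun k => (α (σ.perm.symm k)).len)
    (Equiv.sigmaCongrLeft' (β := fun i => Fin (α i).len) σ.perm
      (Equiv.sigmaCongrRight (fun i => (α i).perm)
        (finSigmaFinEquiv.symm (finSigmaFinEquiv ⟨i, a⟩)))) : Fin _) : ℕ) = _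
  rw [Equiv.symm_apply_apply]
  rfl

theorem inflate_perm_lt_iff (σ : FinPerm) (α : Fin σ.len → FinPerm)
    (x y : (i : Fin σ.len) × Fin (α i).len) :
    (σ.inflate α).perm (finSigmaFinEquiv x) < (σ.inflate α).perm (finSigmaFinEquiv y) ↔
      σ.perm x.1 < σ.perm y.1 ∨ ∃ h : x.1 = y.1,
        (α y.1).perm (Fin.cast (congrArg (fun i => (α i).len) h) x.2) < (α y.1).perm y.2 := by
  rcases x with ⟨i, a⟩
  rcases y with ⟨j, b⟩
  have hval := Fin.lt_def (a := (σ.inflate α).perm (finSigmaFinEquiv ⟨i, a⟩))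
    (b := (σ.inflate α).perm (finSigmaFinEquiv ⟨j, b⟩))
  refine hval.trans ?_
  rw [inflate_perm_apply, inflate_perm_apply, ← Fin.lt_def, finSigmaFinEquiv_lt_iff]
  refine or_congr Iff.rfl ⟨?_, ?_⟩
  · rintro ⟨h, h'⟩
    obtain rfl := σ.perm.injective h
    exact ⟨rfl, h'⟩
  · rintro ⟨h, h'⟩
    obtain rfl : i = j := h
    exact ⟨rfl, h'⟩

theorem inflate_contained {σ τ : FinPerm} {α : Fin σ.len → FinPerm} {β : Fin τ.len → FinPerm}
    (f : Fin σ.len ↪o Fin τ.len) (hf : ∀ i j, σ.perm i < σ.perm j ↔ τ.perm (f i) < τ.perm (f j))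
    (h : ∀ i, (α i).Contained (β (f i))) : (σ.inflate α).Contained (τ.inflate β) := by
  choose g hg using h
  let F : ((i : Fin σ.len) × Fin (α i).len) → (i : Fin τ.len) × Fin (β i).len :=
    fun x => ⟨f x.1, g x.1 x.2⟩
  have hlt : ∀ x y, finSigmaFinEquiv x < finSigmaFinEquiv y ↔
      finSigmaFinEquiv (F x) < finSigmaFinEquiv (F y) := by
    rintro ⟨i, a⟩ ⟨j, b⟩
    rw [finSigmaFinEquiv_lt_iff, finSigmaFinEquiv_lt_iff]
    by_cases hij : i = j
    · subst hij
      simp [F]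
    · simp [F, hij]
  have hperm : ∀ x y, (σ.inflate α).perm (finSigmaFinEquiv x) <
        (σ.inflate α).perm (finSigmaFinEquiv y) ↔
      (τ.inflate β).perm (finSigmaFinEquiv (F x)) <
        (τ.inflate β).perm (finSigmaFinEquiv (F y)) := by
    rintro ⟨i, a⟩ ⟨j, b⟩
    rw [inflate_perm_lt_iff, inflate_perm_lt_iff]
    by_cases hij : i = j
    · subst hij
      simp [F, hg]
    · simp [F, hij, hf]
  let G : Fin (∑ i, (α i).len) → Fin (∑ i, (β i).len) :=
    fun i => finSigmaFinEquiv (F (finSigmaFinEquiv.symm i))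
  have hG : ∀ x, G (finSigmaFinEquiv x) = finSigmaFinEquiv (F x) := fun x => by
    simp only [G, Equiv.symm_apply_apply]
  have hmono : StrictMono G := by
    intro i j hij
    obtain ⟨x, rfl⟩ := finSigmaFinEquiv.surjective i
    obtain ⟨y, rfl⟩ := finSigmaFinEquiv.surjective j
    rw [hG, hG]
    exact (hlt x y).1 hij
  have hpres : ∀ i j, (σ.inflate α).perm i < (σ.inflate α).perm j ↔
      (τ.inflate β).perm (G i) < (τ.inflate β).perm (G j) := by
    intro (i : Fin (∑ i, (α i).len)) (j : Fin (∑ i, (α i).len))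
    obtain ⟨x, rfl⟩ := finSigmaFinEquiv.surjective i
    obtain ⟨y, rfl⟩ := finSigmaFinEquiv.surjective j
    rw [hG, hG]
    exact hperm x y
  exact ⟨OrderEmbedding.ofStrictMono G hmono, hpres⟩

instance instPreorder : Preorder FinPerm where
  le := Contained
  le_refl _ := ⟨RelEmbedding.refl _, fun _ _ => Iff.rfl⟩
  le_trans := by
    rintro σ τ π ⟨f, hf⟩ ⟨g, hg⟩
    exact ⟨f.trans g, fun i j => (hf i j).trans (hg _ _)⟩

/-- Label the entries of `σ` by the blocks that inflate them: containment of these `U`-labeled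
permutations inflates to containment. The labels live in `Type`, hence universe `0`. -/
theorem IsLWQO.isWQO_inflation {C U : Set FinPerm} (hC : IsLWQO.{0} C) (hU : IsWQO U) :
    IsWQO (inflation C U) := by
  have hU' : WellQuasiOrderedLE U := ⟨hU⟩
  unfold IsWQO
  rw [Set.partiallyWellOrderedOn_iff_exists_lt]
  intro π hπ
  choose σ hσ α hα hπ using hπ
  obtain ⟨m, n, hmn, f, hf, hl⟩ := (hC U hU').exists_lt
    (f := fun n => ⟨σ n, fun i => ⟨α n i, (hα n i).1⟩⟩) hσ
  refine ⟨m, n, hmn, ?_⟩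
  rw [hπ, hπ]
  exact inflate_contained f hf hl

end FinPerm

theorem mainTheorem11 (C : Set FinPerm) (hC : FinPerm.IsClass C)
    (hS : FinPerm.GeometricallyGriddable {σ ∈ C | σ.IsSimple}) :
    FinPerm.IsLWQO.{u} C ∧
      ∀ U : Set FinPerm, FinPerm.IsClass U → FinPerm.IsWQO U →
        FinPerm.IsWQO (FinPerm.inflation C U) :=
  ⟨hC.isLWQO_of_isSimple hS.isLWQO,
    fun _ _ hU => (hC.isLWQO_of_isSimple hS.isLWQO).isWQO_inflation hU⟩
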